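/- Let $\Gamma=(V,E)$ be a finite connected acyclic graph and let $v\in V$. On the Hilbert space $W_v=(\mathbb{C}^2)^{\otimes (V\setminus\{v\})}$, with one qubit for each vertex other than $v$, let $X_w$ and $Z_w$ denote the Pauli operators $X$ and $Z$ acting on the qubit $w$. Let $\langle S\rangle_{\mathrm{Lie}}$ denote the real Lie algebra generated by a set $S$ of operators under the commutator. The standard reduced dynamical Lie algebra of $(\Gamma,v)$ is $$\mathfrak{g}^{v}_{\Gamma,\mathrm{std}}=\Big\langle\, i\sum_{w\ne v}X_w,\;\; i\Big(\sum_{\{w,w'\}\in E,\ w,w'\neq v}Z_wZ_{w'}+\sum_{\{v,w\}\in E}Z_w\Big)\Big\rangle_{\mathrm{Lie}} .$$ Let $\Gamma_v$ be the graph obtained from $\Gamma$ by deleting $v$ and all edges incident to it; its free dynamical Lie algebra is $$\mathfrak{g}_{\Gamma_v,\mathrm{free}}=\Big\langle \{iX_w : w\in V\setminus\{v\}\}\cup\{iZ_wZ_{w'} : \{w,w'\}\in E,\ w,w'\neq v\}\Big\rangle_{\mathrm{Lie}} .$$ For $w\in V$ at distance $j\geq 1$ from $v$, let $v=w_0,w_1,\dots,w_j=w$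 be the unique path from $v$ to $w$, and call $(\deg w_1,\dots,\deg w_j)\in(\mathbb{Z}/2)^j$ (degrees taken in $\Gamma$ and reduced modulo $2$) the parity-degree sequence of $w$. A leaf is a vertex of degree $1$ in $\Gamma$. Suppose that for every integer $j>0$ the parity-degree sequences of the leaves of $\Gamma$ at distance $j$ from $v$ are pairwise distinct. Then $$\mathfrak{g}^{v}_{\Gamma,\mathrm{std}}\supseteq\mathfrak{g}_{\Gamma_v,\mathrm{free}} .$$ -/

import Mathlib

attribute [local instance 100] LieRing.ofAssociativeRing

namespace QAOA

noncomputable section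

/-- Operators on the Hilbert space `(ℂ²)^{⊗ ι}` of qubits labelled by `ι`, written as matrices in the
computational basis, which is indexed by the bit strings `ι → Fin 2`. -/
abbrev Op (ι : Type*) := Matrix (ι → Fin 2) (ι → Fin 2) ℂ

/-- The Pauli matrix `X`. -/
def pauliX : Matrix (Fin 2) (Fin 2) ℂ := !![0, 1; 1, 0]

/-- The Pauli matrix `Z`. -/
def pauliZ : Matrix (Fin 2) (Fin 2) ℂ := !![1, 0; 0, -1]

/-- The one-qubit operator `P` acting on the qubit `w`, tensored with the identity on all the other
qubits. -/
def localOp {ι : Type*} [Fintype ι] [DecidableEq ι] (w : ι) (P : Matrix (Fin 2) (Fin 2) ℂ) : Op ι :=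
  Matrix.of fun x y => if ∀ u, u ≠ w → x u = y u then P (x w) (y w) else 0

/-- The operator `X_w`. -/
def opX {ι : Type*} [Fintype ι] [DecidableEq ι] (w : ι) : Op ι := localOp w pauliX

/-- The operator `Z_w`. -/
def opZ {ι : Type*} [Fintype ι] [DecidableEq ι] (w : ι) : Op ι := localOp w pauliZ

theorem opZ_eq_diagonal {ι : Type*} [Fintype ι] [DecidableEq ι] (w : ι) :
    (opZ w : Op ι) = Matrix.diagonal fun x => if x w = 0 then 1 else -1 := by
  ext x y
  rw [opZ, localOp, Matrix.of_apply, Matrix.diagonal_apply]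
  by_cases hxy : x = y
  · subst hxy
    have h2 : ∀ a : Fin 2, pauliZ a a = if a = 0 then 1 else -1 := by
      intro a
      fin_cases a <;> simp [pauliZ]
    simp [h2]
  · rw [if_neg hxy]
    split_ifs with h
    · have hw : x w ≠ y w := by
        intro hw
        apply hxy
        funext u
        by_cases hu : u = w
        · rw [hu, hw]
        · exact h u hu
      have h2 : ∀ a b : Fin 2, a ≠ b → pauliZ a b = 0 := by
        intro a b
        fin_cases a <;> fin_cases b <;> simp [pauliZ]
      exact h2 _ _ hw
    · rfl

theorem opZ_mul_comm {ι : Type*} [Fintype ι] [DecidableEq ι] (w w' : ι) :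
    (opZ w * opZ w' : Op ι) = opZ w' * opZ w := by
  simp only [opZ_eq_diagonal, Matrix.diagonal_mul_diagonal, mul_comm]

/-- The operator `Z_w Z_{w'}` attached to the unordered pair `s(w, w')`. -/
def opZZ {ι : Type*} [Fintype ι] [DecidableEq ι] : Sym2 ι → Op ι :=
  Sym2.lift ⟨fun w w' => opZ w * opZ w', opZ_mul_comm⟩

/-- The free dynamical Lie algebra of a graph: the real Lie algebra generated by all `i X_w` for
vertices `w` and all `i Z_w Z_{w'}` for edges `w w'`, under the commutator bracket. -/
def freeDLA {ι : Type*} [Fintype ι] [DecidableEq ι] (H : SimpleGraph ι) :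
    LieSubalgebra ℝ (Op ι) :=
  LieSubalgebra.lieSpan ℝ (Op ι)
    ((Set.range fun w : ι => Complex.I • (opX w : Op ι)) ∪
      (fun e : Sym2 ι => Complex.I • (opZZ e : Op ι)) '' H.edgeSet)

/-- The reduced graph at `v`: the vertex `v` and all edges at `v` are removed. -/
abbrev reducedGraph {V : Type*} (G : SimpleGraph V) (v : V) : SimpleGraph {w : V // w ≠ v} :=
  G.comap Subtype.val

/-- The reduced mixer Hamiltonian `∑_{w ≠ v} X_w`. -/
def reducedMixer {V : Type*} [Fintype V] [DecidableEq V] (v : V) : Op {w : V // w ≠ v} :=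
  ∑ w : {w : V // w ≠ v}, opX w

/-- The reduced MaxCut Hamiltonian
`∑_{w w' ∈ E, w, w' ≠ v} Z_w Z_{w'} + ∑_{v w ∈ E} Z_w`. -/
def reducedProblem {V : Type*} [Fintype V] [DecidableEq V] (G : SimpleGraph V)
    [DecidableRel G.Adj] (v : V) : Op {w : V // w ≠ v} :=
  ∑ e ∈ (reducedGraph G v).edgeFinset, opZZ e +
    ∑ w : {w : V // w ≠ v} with G.Adj v w.1, opZ w

/-- The standard reduced dynamical Lie algebra of `(G, v)`: the real Lie algebra generated by
`i H_M^v` and `i H_P^v`. -/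
def standardReducedDLA {V : Type*} [Fintype V] [DecidableEq V] (G : SimpleGraph V)
    [DecidableRel G.Adj] (v : V) : LieSubalgebra ℝ (Op {w : V // w ≠ v}) :=
  LieSubalgebra.lieSpan ℝ (Op {w : V // w ≠ v})
    {Complex.I • reducedMixer v, Complex.I • reducedProblem G v}

/-- The sequence `(deg w_1, …, deg w_j)` modulo `2` along a walk `v = w_0, w_1, …, w_j = w`. -/
def parityProfile {V : Type*} [Fintype V] (G : SimpleGraph V)
    [DecidableRel G.Adj] {v w : V} (p : G.Walk v w) : List (ZMod 2) :=
  p.support.tail.map fun u => (G.degree u : ZMod 2)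

end

end QAOA


/-!
Deleting `v` turns the tree into a rooted forest, whose roots are the neighbours of `v`, and the
problem Hamiltonian into `∑_w Z_w Z_{p(w)}`, where `p(w)` is the parent of `w` and `Z_{p(w)} = 1`
for a root. Call a set of vertices resolved if the sum of its `X_w` and the sum of its parent edges
`Z_w Z_{p(w)}` both belong to the Lie algebra (up to the factor `i`).

All vertices together are resolved. A polynomial in `ad (∑ X_w)` separates the one-qubit terms of
the problem Hamiltonian from the others, and this resolves the roots. If an independent set `C` is
resolved, then `ad² (∑_{w ∈ C} X_w)` singles out the edges at `C`, which resolves the children of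
`C`. Moreover, commuting `∑_{w ∈ C} X_w` repeatedly with the edges from `C` to its children
multiplies each `X_w` by powers of the square of `∑ Z_c`, summed over the children `c` of `w`. Its
spectrum determines the parity of the number of children, so that `C` splits according to this
parity. By induction on the depth, every class of vertices with equal parity-degree sequences is
resolved.

From a resolved single vertex one obtains `X` at its parent. A longest parity-degree sequence occurs
only at leaves, hence only once by hypothesis, and working back from the longest sequences to the
shortest yields every `X_w`: in each class all vertices but at most one have a child.
-/
namespace QAOA

noncomputable section

open Complex

section HermBracket

variable {R S : Type*} [Ring R] [Algebra ℂ R] [Ring S] [Algebra ℂ S]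

/-- The commutator rescaled to `(i / 2) [A, B]`, so that it preserves Hermitian operators and sends
`X`, `Z` to `Y`. It corresponds to the commutator of `i A` and `i B`. -/
def hermBracket : R →ₗ[ℂ] R →ₗ[ℂ] R :=
  (I / 2) • (LinearMap.mul ℂ R - (LinearMap.mul ℂ R).flip)

theorem hermBracket_apply (A B : R) : hermBracket A B = (I / 2) • (A * B - B * A) := rfl

theorem hermBracket_mul_right (A B C : R) :
    hermBracket A (B * C) = hermBracket A B * C + B * hermBracket A C := by
  simp only [hermBracket_apply, smul_mul_assoc, mul_smul_comm, ← smul_add]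
  congr 1
  noncomm_ring

theorem map_hermBracket (φ : R →ₐ[ℂ] S) (A B : R) :
    φ (hermBracket A B) = hermBracket (φ A) (φ B) := by
  simp only [hermBracket_apply, map_smul, map_sub, map_mul]

theorem hermBracket_eq_zero {A B : R} (h : Commute A B) : hermBracket A B = 0 := by
  rw [hermBracket_apply, h.eq, sub_self, smul_zero]

theorem hermBracket_mul_mul {A B s t : R} (hsB : Commute s B) (htA : Commute t A)
    (hst : Commute s t) : hermBracket (A * s) (B * t) = hermBracket A B * (s * t) := by
  simp only [hermBracket_apply, smul_mul_assoc, sub_mul]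
  rw [hsB.mul_mul_mul_comm, htA.mul_mul_mul_comm, hst.eq]

theorem hermBracket_sum_sum {α : Type*} {C : Finset α} {a b : α → R}
    (h : ∀ c ∈ C, ∀ d ∈ C, c ≠ d → Commute (a c) (b d)) :
    hermBracket (∑ c ∈ C, a c) (∑ c ∈ C, b c) = ∑ c ∈ C, hermBracket (a c) (b c) := by
  simp only [map_sum, LinearMap.sum_apply]
  refine Finset.sum_congr rfl fun d hd => ?_
  exact Finset.sum_eq_single_of_mem d hd fun c hc hcd => hermBracket_eq_zero (h c hc d hd hcd)

/-- The polynomial `ad⁴ + 4 ad²` in `ad = hermBracket A`. For the mixer `A = ∑ X_w`, `ad²` acts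
by `-1` on `Z_w` and has eigenvalues `0` and `-4` on the span of the orbit of `Z_u Z_w`, so this
filter keeps the one-qubit terms and kills the two-qubit terms. -/
def oneBodyFilter (A : R) : R →ₗ[ℂ] R := hermBracket A ^ 4 + 4 • hermBracket A ^ 2

theorem oneBodyFilter_apply (A B : R) :
    oneBodyFilter A B = hermBracket A (hermBracket A (hermBracket A (hermBracket A B))) +
      4 • hermBracket A (hermBracket A B) := rfl

theorem oneBodyFilter_rotation {A B B' : R} (hB : hermBracket A B = B')
    (hB' : hermBracket A B' = -B) : oneBodyFilter A B = (-3 : ℤ) • B := by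
  simp only [oneBodyFilter_apply, hB, hB', map_neg]
  module

theorem oneBodyFilter_mul_rotation {A B B' C C' : R} (hB : hermBracket A B = B')
    (hB' : hermBracket A B' = -B) (hC : hermBracket A C = C') (hC' : hermBracket A C' = -C) :
    oneBodyFilter A (B * C) = 0 := by
  simp only [oneBodyFilter_apply, hermBracket_mul_right, map_add, map_neg, hB, hB', hC, hC',
    neg_mul, mul_neg]
  module

end HermBracket

section Pauli

variable {ι : Type*} [Fintype ι] [DecidableEq ι]

theorem localOp_apply (w : ι) (P : Matrix (Fin 2) (Fin 2) ℂ) (x y : ι → Fin 2) :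
    localOp w P x y = if ∀ u, u ≠ w → x u = y u then P (x w) (y w) else 0 := rfl

theorem localOp_mul_apply (w : ι) (P : Matrix (Fin 2) (Fin 2) ℂ) (M : Op ι) (x y : ι → Fin 2) :
    (localOp w P * M) x y = ∑ a, P (x w) a * M (Function.update x w a) y := by
  rw [Matrix.mul_apply]
  refine (Finset.sum_of_injOn (Function.update x w) ?_ ?_ ?_ ?_).symm
  · exact (Function.update_injective x w).injOn
  · exact fun _ _ => Finset.mem_univ _
  · intro z _ hz
    rw [localOp_apply, if_neg, zero_mul]
    refine fun h => hz ⟨z w, Finset.mem_coe.2 (Finset.mem_univ _), ?_⟩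
    exact Function.update_eq_iff.2 ⟨rfl, h⟩
  · intro a _
    rw [localOp_apply, if_pos fun u hu => (Function.update_of_ne hu _ _).symm,
      Function.update_self]

theorem localOp_mul (w : ι) (P Q : Matrix (Fin 2) (Fin 2) ℂ) :
    localOp w (P * Q) = localOp w P * localOp w Q := by
  ext x y
  have hoff (a : Fin 2) :
      (∀ u, u ≠ w → Function.update x w a u = y u) ↔ ∀ u, u ≠ w → x u = y u :=
    forall₂_congr fun u hu => by rw [Function.update_of_ne hu]
  rw [localOp_mul_apply]
  simp only [localOp_apply, Function.update_self, hoff, mul_ite, mul_zero, Matrix.mul_apply]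
  split_ifs
  · rfl
  · rw [Finset.sum_const_zero]

theorem localOp_mul_localOp_apply {u w : ι} (h : u ≠ w) (P Q : Matrix (Fin 2) (Fin 2) ℂ)
    (x y : ι → Fin 2) :
    (localOp u P * localOp w Q) x y =
      if ∀ t, t ≠ u → t ≠ w → x t = y t then P (x u) (y u) * Q (x w) (y w) else 0 := by
  have hoff (a : Fin 2) : (∀ t, t ≠ w → Function.update x u a t = y t) ↔
      a = y u ∧ ∀ t, t ≠ u → t ≠ w → x t = y t := by
    refine ⟨fun H => ⟨?_, fun t htu htw => ?_⟩, fun ⟨ha, H⟩ t htw => ?_⟩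
    · simpa using H u h
    · simpa [htu] using H t htw
    · rcases eq_or_ne t u with rfl | htu
      · simpa using ha
      · simpa [htu] using H t htu htw
  simp only [localOp_mul_apply, localOp_apply, Function.update_of_ne h.symm, hoff, ite_and, mul_ite,
    mul_zero, Finset.sum_ite_eq', Finset.mem_univ, if_true]

theorem commute_localOp_localOp {u w : ι} (h : u ≠ w) (P Q : Matrix (Fin 2) (Fin 2) ℂ) :
    Commute (localOp u P) (localOp w Q) := by
  ext x y
  rw [localOp_mul_localOp_apply h, localOp_mul_localOp_apply h.symm, mul_comm (P _ _)]
  simp only [imp.swap]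

/-- The inclusion `P ↦ localOp w P` of the operators on the qubit `w` as a homomorphism of
algebras. -/
def localOpHom (w : ι) : Matrix (Fin 2) (Fin 2) ℂ →ₐ[ℂ] Op ι :=
  AlgHom.ofLinearMap
    { toFun := localOp w
      map_add' := fun P Q => by
        ext x y
        simp only [localOp_apply, Matrix.add_apply]
        split_ifs <;> simp
      map_smul' := fun c P => by
        ext x y
        simp [localOp_apply] }
    (by
      ext x y
      have hxy : (∀ u, u ≠ w → x u = y u) ∧ x w = y w ↔ x = y := by
        refine ⟨fun h => funext fun u => ?_, fun h => by simp [h]⟩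
        exact (eq_or_ne u w).elim (fun hu => hu ▸ h.2) (h.1 u)
      simp only [LinearMap.coe_mk, AddHom.coe_mk, localOp_apply, Matrix.one_apply, ← ite_and, hxy])
    (localOp_mul w)

theorem hermBracket_localOp (w : ι) (P Q : Matrix (Fin 2) (Fin 2) ℂ) :
    hermBracket (localOp w P) (localOp w Q) = localOp w (hermBracket P Q) :=
  (map_hermBracket (localOpHom w) P Q).symm

theorem localOp_neg (w : ι) (P : Matrix (Fin 2) (Fin 2) ℂ) : localOp w (-P) = -localOp w P :=
  map_neg (localOpHom w) P

theorem opZ_mul_self (w : ι) : (opZ w * opZ w : Op ι) = 1 := by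
  have h : pauliZ * pauliZ = 1 := by simp [pauliZ, Matrix.one_fin_two]
  rw [opZ, ← localOp_mul, h]
  exact map_one (localOpHom w)

/-- The Pauli matrix `Y`. -/
def pauliY : Matrix (Fin 2) (Fin 2) ℂ := !![0, -I; I, 0]

theorem hermBracket_pauliX_pauliZ : hermBracket pauliX pauliZ = pauliY := by
  ext a b
  fin_cases a <;> fin_cases b <;> simp [hermBracket_apply, pauliX, pauliY, pauliZ] <;> ring

theorem hermBracket_pauliX_pauliY : hermBracket pauliX pauliY = -pauliZ := by
  ext a b
  fin_cases a <;> fin_cases b <;> simp [hermBracket_apply, pauliX, pauliY, pauliZ] <;>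
    ring_nf <;> simp

theorem hermBracket_pauliZ_pauliY : hermBracket pauliZ pauliY = pauliX := by
  ext a b
  fin_cases a <;> fin_cases b <;> simp [hermBracket_apply, pauliX, pauliY, pauliZ] <;>
    ring_nf <;> simp

/-- The algebra generated by the `Z_w` with `w ∉ C`: the diagonal operators not involving the
qubits of `C`. They serve as the coefficients of operators acting on the qubits of `C`. -/
def spectatorAlgebra (C : Finset ι) : Subalgebra ℂ (Op ι) :=
  Algebra.adjoin ℂ (opZ '' {w | w ∉ C})

theorem opZ_mem_spectatorAlgebra {C : Finset ι} {w : ι} (hw : w ∉ C) :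
    opZ w ∈ spectatorAlgebra C :=
  Algebra.subset_adjoin ⟨w, hw, rfl⟩

theorem commute_of_mem_spectatorAlgebra {C : Finset ι} {f A : Op ι} (hf : f ∈ spectatorAlgebra C)
    (hA : ∀ w ∉ C, Commute (opZ w) A) : Commute f A := by
  have hle : spectatorAlgebra C ≤ Subalgebra.centralizer ℂ {A} := by
    refine Algebra.adjoin_le ?_
    rintro _ ⟨w, hw, rfl⟩
    exact Subalgebra.mem_centralizer_iff ℂ |>.2 fun B hB => by
      rw [Set.mem_singleton_iff.1 hB, (hA w hw).eq]
  exact (Subalgebra.mem_centralizer_iff ℂ |>.1 (hle hf) A rfl).symm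

theorem commute_spectator_localOp {C : Finset ι} {f : Op ι} (hf : f ∈ spectatorAlgebra C)
    {w : ι} (hw : w ∈ C) (P : Matrix (Fin 2) (Fin 2) ℂ) : Commute f (localOp w P) :=
  commute_of_mem_spectatorAlgebra hf fun _ hu =>
    commute_localOp_localOp (ne_of_mem_of_not_mem hw hu).symm _ _

theorem commute_spectator_spectator {C D : Finset ι} {f g : Op ι} (hf : f ∈ spectatorAlgebra C)
    (hg : g ∈ spectatorAlgebra D) : Commute f g :=
  commute_of_mem_spectatorAlgebra hf fun w _ =>
    (commute_of_mem_spectatorAlgebra hg fun u _ => opZ_mul_comm u w).symm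

theorem hermBracket_sum_localOp_mul {C : Finset ι} {f g : ι → Op ι}
    (hf : ∀ w ∈ C, f w ∈ spectatorAlgebra C) (hg : ∀ w ∈ C, g w ∈ spectatorAlgebra C)
    (P Q : Matrix (Fin 2) (Fin 2) ℂ) :
    hermBracket (∑ w ∈ C, localOp w P * f w) (∑ w ∈ C, localOp w Q * g w) =
      ∑ w ∈ C, localOp w (hermBracket P Q) * (f w * g w) := by
  have hfg : ∀ c ∈ C, ∀ d ∈ C, Commute (f c) (g d) := fun c hc d hd =>
    commute_spectator_spectator (hf c hc) (hg d hd)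
  rw [hermBracket_sum_sum]
  · refine Finset.sum_congr rfl fun w hw => ?_
    rw [hermBracket_mul_mul (commute_spectator_localOp (hf w hw) hw Q)
      (commute_spectator_localOp (hg w hw) hw P) (hfg w hw w hw), hermBracket_localOp]
  · intro c hc d hd hcd
    exact ((commute_localOp_localOp hcd P Q).mul_right
      (commute_spectator_localOp (hg d hd) hc P).symm).mul_left
        ((commute_spectator_localOp (hf c hc) hd Q).mul_right (hfg c hc d hd))

/-- The operator `∑_{w ∈ C} X_w`. -/
def sumX (C : Finset ι) : Op ι := ∑ w ∈ C, opX w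

theorem hermBracket_sumX_spectator {C : Finset ι} {f : Op ι} (hf : f ∈ spectatorAlgebra C) :
    hermBracket (sumX C) f = 0 :=
  hermBracket_eq_zero (Commute.sum_left _ _ _ fun _ hw =>
    (commute_spectator_localOp hf hw pauliX).symm)

theorem hermBracket_sumX_localOp {C : Finset ι} {w : ι} (hw : w ∈ C)
    (P : Matrix (Fin 2) (Fin 2) ℂ) :
    hermBracket (sumX C) (localOp w P) = localOp w (hermBracket pauliX P) := by
  rw [sumX, map_sum, LinearMap.sum_apply, ← hermBracket_localOp]
  exact Finset.sum_eq_single_of_mem w hw fun u _ huw =>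
    hermBracket_eq_zero (commute_localOp_localOp huw pauliX P)

theorem hermBracket_sumX_opZ_mul {C : Finset ι} {w : ι} (hw : w ∈ C) {f : Op ι}
    (hf : f ∈ spectatorAlgebra C) :
    hermBracket (sumX C) (hermBracket (sumX C) (opZ w * f)) = -(opZ w * f) := by
  rw [opZ]
  simp only [hermBracket_mul_right, hermBracket_sumX_localOp hw, hermBracket_sumX_spectator hf,
    mul_zero, add_zero, hermBracket_pauliX_pauliZ, hermBracket_pauliX_pauliY, localOp_neg, neg_mul]

/-- The operator `Z_w`, extended by the identity to a missing qubit. -/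
def optZ (o : Option ι) : Op ι := o.elim 1 opZ

theorem optZ_mul_self (o : Option ι) : (optZ o * optZ o : Op ι) = 1 := by
  cases o with
  | none => exact one_mul 1
  | some w => exact opZ_mul_self w

theorem optZ_mem_spectatorAlgebra {C : Finset ι} {o : Option ι} (ho : ∀ u ∈ C, o ≠ some u) :
    optZ o ∈ spectatorAlgebra C := by
  cases o with
  | none => exact one_mem _
  | some w => exact opZ_mem_spectatorAlgebra fun hw => ho w hw rfl

end Pauli

section Hamiltonians

variable {ι : Type*} [Fintype ι] [DecidableEq ι]

/-- The Hamiltonians of a real Lie algebra `g` of operators: the operators `A` with `i A ∈ g`. -/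
def hamiltonians (g : LieSubalgebra ℝ (Op ι)) : Submodule ℝ (Op ι) :=
  g.toSubmodule.comap (DistribSMul.toLinearMap ℝ (Op ι) I)

variable {g : LieSubalgebra ℝ (Op ι)}

theorem mem_hamiltonians {A : Op ι} : A ∈ hamiltonians g ↔ I • A ∈ g := Iff.rfl

theorem hermBracket_mem_hamiltonians {A B : Op ι} (hA : A ∈ hamiltonians g)
    (hB : B ∈ hamiltonians g) : hermBracket A B ∈ hamiltonians g := by
  have h : I • hermBracket A B = (1 / 2 : ℝ) • ⁅I • A, I • B⁆ := by
    rw [hermBracket_apply, Ring.lie_def, smul_mul_smul_comm, smul_mul_smul_comm, ← smul_sub,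
      ← Complex.coe_smul, smul_smul, smul_smul]
    congr 1
    push_cast
    ring
  rw [mem_hamiltonians, h]
  exact g.smul_mem _ (g.lie_mem hA hB)

theorem sum_opX_mul_sq_mem_hamiltonians {C : Finset ι} {f r : ι → Op ι}
    (hf : ∀ w ∈ C, f w ∈ spectatorAlgebra C) (hr : ∀ w ∈ C, r w ∈ spectatorAlgebra C)
    (hZ : ∑ w ∈ C, opZ w * f w ∈ hamiltonians g) (hX : ∑ w ∈ C, opX w * r w ∈ hamiltonians g) :
    ∑ w ∈ C, opX w * (f w ^ 2 * r w) ∈ hamiltonians g := by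
  have h := hermBracket_mem_hamiltonians hZ (hermBracket_mem_hamiltonians hX hZ)
  simp only [opX, opZ] at h
  rw [hermBracket_sum_localOp_mul hr hf,
    hermBracket_sum_localOp_mul hf fun w hw => mul_mem (hr w hw) (hf w hw),
    hermBracket_pauliX_pauliZ, hermBracket_pauliZ_pauliY] at h
  have hcomm : ∀ w ∈ C, opX w * (f w ^ 2 * r w) = localOp w pauliX * (f w * (r w * f w)) :=
    fun w hw => by rw [(commute_spectator_spectator (hr w hw) (hf w hw)).eq, sq, mul_assoc, opX]
  rwa [Finset.sum_congr rfl hcomm]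

theorem sum_opX_mul_aeval_sq_mem_hamiltonians {C : Finset ι} {f : ι → Op ι}
    (hf : ∀ w ∈ C, f w ∈ spectatorAlgebra C) (hZ : ∑ w ∈ C, opZ w * f w ∈ hamiltonians g)
    (hX : sumX C ∈ hamiltonians g) (q : Polynomial ℝ) :
    ∑ w ∈ C, opX w * Polynomial.aeval (f w ^ 2) q ∈ hamiltonians g := by
  have hpow (n : ℕ) : ∑ w ∈ C, opX w * (f w ^ 2) ^ n ∈ hamiltonians g := by
    induction n with
    | zero => simpa only [pow_zero, mul_one, sumX] using hX
    | succ n ih =>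
      simp only [pow_succ' (_ ^ 2)]
      exact sum_opX_mul_sq_mem_hamiltonians hf
        (fun w hw => pow_mem (pow_mem (hf w hw) 2) n) hZ ih
  induction q using Polynomial.induction_on' with
  | add q r hq hr =>
    simp only [map_add, mul_add, Finset.sum_add_distrib]
    exact add_mem hq hr
  | monomial n a =>
    simp only [Polynomial.aeval_monomial, ← Algebra.smul_def, mul_smul_comm, ← Finset.smul_sum]
    exact Submodule.smul_mem _ a (hpow n)

end Hamiltonians

section SumZ

variable {ι : Type*}

/-- The eigenvalue of `∑_{w ∈ T} Z_w` on the computational basis vector labelled by `x`. -/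
def spinSum (T : Finset ι) (x : ι → Fin 2) : ℤ := ∑ w ∈ T, if x w = 0 then 1 else -1

theorem natAbs_spinSum_le (T : Finset ι) (x : ι → Fin 2) : (spinSum T x).natAbs ≤ T.card := by
  refine (Int.natAbs_sum_le _ _).trans ((Finset.sum_le_card_nsmul _ _ 1 fun w _ => ?_).trans ?_)
  · split_ifs <;> rfl
  · rw [smul_eq_mul, mul_one]

theorem odd_natAbs_spinSum (T : Finset ι) (x : ι → Fin 2) :
    Odd (spinSum T x).natAbs ↔ Odd T.card := by
  have h : (spinSum T x : ZMod 2) = T.card := by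
    rw [spinSum, Finset.card_eq_sum_ones, Int.cast_sum, Nat.cast_sum]
    refine Finset.sum_congr rfl fun w _ => ?_
    split_ifs <;> decide
  rw [Int.natAbs_odd, ← ZMod.intCast_eq_one_iff_odd, h, ZMod.natCast_eq_one_iff_odd]

theorem exists_polynomial_eval_sq_eq_parity (N : ℕ) :
    ∃ q : Polynomial ℝ, ∀ n ≤ N, q.eval ((n : ℝ) ^ 2) = if Odd n then 1 else 0 := by
  refine ⟨Lagrange.interpolate (Finset.range (N + 1)) (fun n : ℕ => (n : ℝ) ^ 2)
    fun n => if Odd n then 1 else 0, fun n hn => ?_⟩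
  have hinj : Set.InjOn (fun n : ℕ => (n : ℝ) ^ 2) (Finset.range (N + 1)) := fun a _ b _ hab =>
    Nat.cast_injective ((sq_eq_sq₀ (Nat.cast_nonneg a) (Nat.cast_nonneg b)).1 hab)
  exact Lagrange.eval_interpolate_at_node (v := fun n : ℕ => (n : ℝ) ^ 2) _ hinj
    (Finset.mem_range.2 (Nat.lt_succ_of_le hn))

variable [Fintype ι] [DecidableEq ι]

/-- The operator `∑_{w ∈ T} Z_w`. -/
def sumZ (T : Finset ι) : Op ι := ∑ w ∈ T, opZ w

theorem sumZ_eq_diagonal (T : Finset ι) :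
    sumZ T = Matrix.diagonal fun x => (spinSum T x : ℂ) := by
  ext x y
  simp only [sumZ, opZ_eq_diagonal, Matrix.sum_apply, Matrix.diagonal_apply, spinSum]
  split_ifs with h
  · push_cast
    rfl
  · exact Finset.sum_const_zero

variable (ι) in
theorem exists_aeval_sumZ_sq_eq_parity :
    ∃ q : Polynomial ℝ, ∀ T : Finset ι,
      Polynomial.aeval (sumZ T ^ 2) q = if Odd T.card then 1 else 0 := by
  obtain ⟨q, hq⟩ := exists_polynomial_eval_sq_eq_parity (Fintype.card ι)
  refine ⟨q, fun T => ?_⟩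
  have hdiag : sumZ T ^ 2 = Matrix.diagonalAlgHom ℝ
      (fun x => algebraMap ℝ ℂ (((spinSum T x).natAbs : ℝ) ^ 2)) := by
    rw [sumZ_eq_diagonal, Matrix.diagonal_pow, Matrix.diagonalAlgHom_apply]
    congr 1
    funext x
    rw [Pi.pow_apply, Nat.cast_natAbs, Int.cast_abs, sq_abs, map_pow, map_intCast]
  have heval (x : ι → Fin 2) : q.eval (((spinSum T x).natAbs : ℝ) ^ 2) =
      if Odd T.card then 1 else 0 := by
    rw [hq _ ((natAbs_spinSum_le T x).trans T.card_le_univ), if_congr (odd_natAbs_spinSum T x)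
      rfl rfl]
  rw [hdiag, Polynomial.aeval_algHom_apply, Polynomial.aeval_pi_apply]
  simp only [Polynomial.aeval_algebraMap_apply, Polynomial.coe_aeval_eq_eval, heval,
    Matrix.diagonalAlgHom_apply]
  split_ifs <;> simp

theorem sumZ_mem_spectatorAlgebra {C T : Finset ι} (h : Disjoint T C) :
    sumZ T ∈ spectatorAlgebra C :=
  sum_mem fun _ hw => opZ_mem_spectatorAlgebra (Finset.disjoint_left.1 h hw)

end SumZ

section Forest

variable {ι : Type*} [Fintype ι]

/-- The vertices without a parent, for a rooted forest given by its parent function `p`. -/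
def roots (p : ι → Option ι) : Finset ι := {w | p w = none}

theorem mem_roots {p : ι → Option ι} {w : ι} : w ∈ roots p ↔ p w = none := by
  rw [roots, Finset.mem_filter_univ]

variable [DecidableEq ι]

/-- The vertices whose parent lies in `C`, for a rooted forest given by its parent function `p`. -/
def children (p : ι → Option ι) (C : Finset ι) : Finset ι := {w | ∃ u ∈ C, p w = some u}

variable {p : ι → Option ι} {A B C : Finset ι}

theorem mem_children {w : ι} : w ∈ children p C ↔ ∃ u ∈ C, p w = some u := by
  rw [children, Finset.mem_filter_univ]

theorem mem_children_singleton {u w : ι} : w ∈ children p {u} ↔ p w = some u := by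
  simp only [mem_children, Finset.mem_singleton, exists_eq_left]

theorem children_mono (h : A ⊆ B) : children p A ⊆ children p B := fun _ hw =>
  let ⟨u, hu, hwu⟩ := mem_children.1 hw
  mem_children.2 ⟨u, h hu, hwu⟩

theorem children_eq_biUnion : children p C = C.biUnion fun u => children p {u} := by
  ext w
  simp only [mem_children, Finset.mem_biUnion, Finset.mem_singleton, exists_eq_left]

theorem disjoint_children (h : Disjoint A B) : Disjoint (children p A) (children p B) := by
  refine Finset.disjoint_left.2 fun w hA hB => ?_
  obtain ⟨u, hu, hwu⟩ := mem_children.1 hA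
  obtain ⟨u', hu', hwu'⟩ := mem_children.1 hB
  obtain rfl : u = u' := Option.some.inj (hwu.symm.trans hwu')
  exact Finset.disjoint_left.1 h hu hu'

theorem optZ_parent_mem_spectatorAlgebra {w : ι} (hw : w ∉ children p A) :
    optZ (p w) ∈ spectatorAlgebra A :=
  optZ_mem_spectatorAlgebra fun u hu hwu => hw (mem_children.2 ⟨u, hu, hwu⟩)

/-- The operator `∑_{w ∈ C} Z_w Z_{p(w)}`, summed over the edges from the vertices of `C` to their
parents; a root `w` contributes `Z_w`. -/
def sumE (p : ι → Option ι) (C : Finset ι) : Op ι := ∑ w ∈ C, opZ w * optZ (p w)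

theorem sumE_children (p : ι → Option ι) (C : Finset ι) :
    sumE p (children p C) = ∑ u ∈ C, opZ u * sumZ (children p {u}) := by
  have hdisj : (C : Set ι).PairwiseDisjoint fun u => children p {u} := fun u _ u' _ huu' =>
    disjoint_children (Finset.disjoint_singleton.2 huu')
  rw [sumE, children_eq_biUnion, Finset.sum_biUnion hdisj]
  refine Finset.sum_congr rfl fun u _ => ?_
  rw [sumZ, Finset.mul_sum]
  refine Finset.sum_congr rfl fun w hw => ?_
  rw [mem_children_singleton.1 hw, opZ_mul_comm]
  rfl

-- `ad² (sumX A)` acts by `-1` on the edges with one endpoint in `A` and by `0` on those with none.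
theorem hermBracket_sumX_hermBracket_sumX_sumE (h : Disjoint (A ∩ B) (children p A)) :
    hermBracket (sumX A) (hermBracket (sumX A) (sumE p B)) = -sumE p (B ∩ (A ∪ children p A)) := by
  simp only [sumE, map_sum, ← Finset.filter_mem_eq_inter, Finset.sum_filter,
    ← Finset.sum_neg_distrib]
  refine Finset.sum_congr rfl fun w hwB => ?_
  by_cases hwA : w ∈ A
  · rw [if_pos (Finset.mem_union_left _ hwA)]
    exact hermBracket_sumX_opZ_mul hwA (optZ_parent_mem_spectatorAlgebra
      (Finset.disjoint_left.1 h (Finset.mem_inter.2 ⟨hwA, hwB⟩)))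
  by_cases hwc : w ∈ children p A
  · obtain ⟨u, hu, hwu⟩ := mem_children.1 hwc
    rw [if_pos (Finset.mem_union_right _ hwc), hwu, optZ, Option.elim_some, opZ_mul_comm]
    exact hermBracket_sumX_opZ_mul hu (opZ_mem_spectatorAlgebra hwA)
  · have hspec : opZ w * optZ (p w) ∈ spectatorAlgebra A :=
      mul_mem (opZ_mem_spectatorAlgebra hwA) (optZ_parent_mem_spectatorAlgebra hwc)
    rw [if_neg fun hw => (Finset.mem_union.1 hw).elim hwA hwc, neg_zero,
      hermBracket_sumX_spectator hspec, map_zero]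

theorem oneBodyFilter_sumE (p : ι → Option ι) :
    oneBodyFilter (sumX Finset.univ) (sumE p Finset.univ) = (-3 : ℤ) • sumE p (roots p) := by
  have hZ (w : ι) : hermBracket (sumX Finset.univ) (opZ w) = localOp w pauliY := by
    rw [opZ, hermBracket_sumX_localOp (Finset.mem_univ w), hermBracket_pauliX_pauliZ]
  have hY (w : ι) : hermBracket (sumX Finset.univ) (localOp w pauliY) = -opZ w := by
    rw [hermBracket_sumX_localOp (Finset.mem_univ w), hermBracket_pauliX_pauliY, localOp_neg, opZ]
  rw [sumE, map_sum, sumE, roots, Finset.sum_filter, Finset.smul_sum]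
  refine Finset.sum_congr rfl fun w _ => ?_
  cases p w with
  | none =>
    rw [if_pos rfl, optZ, Option.elim_none, mul_one]
    exact oneBodyFilter_rotation (hZ w) (hY w)
  | some u =>
    rw [if_neg (Option.some_ne_none u), smul_zero]
    exact oneBodyFilter_mul_rotation (hZ w) (hY w) (hZ u) (hY u)

end Forest

section Resolved

variable {ι : Type*} [Fintype ι] [DecidableEq ι] {g : LieSubalgebra ℝ (Op ι)} {p : ι → Option ι}
  {A B C D : Finset ι}

theorem sumX_mem_of_subset (hXA : sumX A ∈ hamiltonians g) (hED : sumE p D ∈ hamiltonians g)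
    (hDA : D ⊆ A) (h : Disjoint D (children p A)) : sumX D ∈ hamiltonians g := by
  have hsum (F : ι → Op ι) : ∑ w ∈ D, F w = ∑ w ∈ A, if w ∈ D then F w else 0 := by
    rw [Finset.sum_ite_mem, Finset.inter_eq_right.2 hDA]
  have hmem : ∀ w ∈ A, (if w ∈ D then optZ (p w) else 0) ∈ spectatorAlgebra A := fun w _ => by
    split_ifs with hw
    · exact optZ_parent_mem_spectatorAlgebra (Finset.disjoint_left.1 h hw)
    · exact zero_mem _
  have hX := sum_opX_mul_sq_mem_hamiltonians (r := 1) hmem (fun _ _ => one_mem _)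
    (by simpa only [sumE, mul_ite, mul_zero, ← hsum] using hED)
    (by simpa only [sumX, Pi.one_apply, mul_one] using hXA)
  simpa only [sumX, ite_pow, sq, optZ_mul_self, mul_zero, Pi.one_apply, mul_one, mul_ite,
    ← hsum] using hX

theorem sumE_inter_mem (hXA : sumX A ∈ hamiltonians g) (hEB : sumE p B ∈ hamiltonians g)
    (h : Disjoint (A ∩ B) (children p A)) :
    sumE p (B ∩ (A ∪ children p A)) ∈ hamiltonians g := by
  rw [← neg_mem_iff, ← hermBracket_sumX_hermBracket_sumX_sumE h]
  exact hermBracket_mem_hamiltonians hXA (hermBracket_mem_hamiltonians hXA hEB)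

/-- A set `C` of vertices is resolved by the Lie algebra `g` if `g` contains both `i ∑_{w ∈ C} X_w`
and the sum `i ∑_{w ∈ C} Z_w Z_{p(w)}` over the parent edges of `C`. The theorem amounts to
resolving every single vertex, starting from the set of all vertices. -/
structure IsResolved (g : LieSubalgebra ℝ (Op ι)) (p : ι → Option ι) (C : Finset ι) : Prop where
  sumX_mem : sumX C ∈ hamiltonians g
  sumE_mem : sumE p C ∈ hamiltonians g

namespace IsResolved

theorem sdiff (hA : IsResolved g p A) (hB : IsResolved g p B) (h : B ⊆ A) :
    IsResolved g p (A \ B) where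
  sumX_mem := by
    rw [sumX, Finset.sum_sdiff_eq_sub h]
    exact sub_mem hA.sumX_mem hB.sumX_mem
  sumE_mem := by
    rw [sumE, Finset.sum_sdiff_eq_sub h]
    exact sub_mem hA.sumE_mem hB.sumE_mem

theorem of_subset (hA : IsResolved g p A) (hC : sumX C ∈ hamiltonians g) (hCA : C ⊆ A)
    (h : Disjoint A (children p C)) : IsResolved g p C where
  sumX_mem := hC
  sumE_mem := by
    have hinter : A ∩ (C ∪ children p C) = C := by
      rw [Finset.inter_union_distrib_left, Finset.inter_eq_right.2 hCA,
        Finset.disjoint_iff_inter_eq_empty.1 h, Finset.union_empty]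
    rw [← hinter]
    exact sumE_inter_mem hC hA.sumE_mem (h.mono_left Finset.inter_subset_right)

protected theorem roots (huniv : IsResolved g p Finset.univ) : IsResolved g p (roots p) := by
  have hE : sumE p (roots p) ∈ hamiltonians g := by
    have hD : ∀ A ∈ hamiltonians g, hermBracket (sumX Finset.univ) A ∈ hamiltonians g :=
      fun _ => hermBracket_mem_hamiltonians huniv.sumX_mem
    have h : oneBodyFilter (sumX Finset.univ) (sumE p Finset.univ) ∈ hamiltonians g :=
      add_mem (hD _ (hD _ (hD _ (hD _ huniv.sumE_mem))))
        (nsmul_mem (hD _ (hD _ huniv.sumE_mem)) 4)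
    rw [oneBodyFilter_sumE, ← Int.cast_smul_eq_zsmul ℝ] at h
    exact (Submodule.smul_mem_iff _ (by norm_num)).1 h
  refine ⟨sumX_mem_of_subset huniv.sumX_mem hE (Finset.subset_univ _) ?_, hE⟩
  refine Finset.disjoint_left.2 fun w hw hw' => ?_
  obtain ⟨u, -, hwu⟩ := mem_children.1 hw'
  exact Option.some_ne_none u (hwu.symm.trans (mem_roots.1 hw))

protected theorem children (huniv : IsResolved g p Finset.univ) (hC : IsResolved g p C)
    (h : Disjoint C (children p C)) : IsResolved g p (children p C) := by
  have hcompl : IsResolved g p (Finset.univ \ C) := huniv.sdiff hC (Finset.subset_univ C)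
  have hsub : children p C ⊆ Finset.univ \ C :=
    Finset.subset_sdiff.2 ⟨Finset.subset_univ _, h.symm⟩
  have hE : sumE p (children p C) ∈ hamiltonians g := by
    have hinter : (Finset.univ \ C) ∩ (C ∪ children p C) = children p C := by
      rw [Finset.inter_union_distrib_left, Finset.inter_eq_right.2 hsub,
        Finset.sdiff_inter_self, Finset.empty_union]
    rw [← hinter]
    exact sumE_inter_mem hC.sumX_mem hcompl.sumE_mem (h.mono_left Finset.inter_subset_left)
  exact ⟨sumX_mem_of_subset hcompl.sumX_mem hE hsub (disjoint_children Finset.disjoint_sdiff), hE⟩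

theorem filter_odd_children (hC : IsResolved g p C)
    (hE : sumE p (children p C) ∈ hamiltonians g) (h : Disjoint C (children p C)) :
    IsResolved g p {u ∈ C | Odd (children p {u}).card} := by
  obtain ⟨q, hq⟩ := exists_aeval_sumZ_sq_eq_parity ι
  have hspec : ∀ u ∈ C, sumZ (children p {u}) ∈ spectatorAlgebra C := fun u hu =>
    sumZ_mem_spectatorAlgebra
      (h.symm.mono_left (children_mono (Finset.singleton_subset_iff.2 hu)))
  rw [sumE_children] at hE
  have hX := sum_opX_mul_aeval_sq_mem_hamiltonians hspec hE hC.sumX_mem q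
  simp only [hq, mul_ite, mul_one, mul_zero, ← Finset.sum_filter] at hX
  exact hC.of_subset hX (Finset.filter_subset _ _)
    (h.mono_right (children_mono (Finset.filter_subset _ _)))

theorem filter_parity_children (hC : IsResolved g p C)
    (hE : sumE p (children p C) ∈ hamiltonians g)
    (h : Disjoint C (children p C)) (a : ZMod 2) :
    IsResolved g p {u ∈ C | ((children p {u}).card : ZMod 2) = a} := by
  have hodd := hC.filter_odd_children hE h
  obtain rfl | rfl : a = 0 ∨ a = 1 := by
    revert a
    decide
  · convert hC.sdiff hodd (Finset.filter_subset _ _) using 1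
    rw [← Finset.filter_not]
    simp only [Nat.not_odd_iff_even, ZMod.natCast_eq_zero_iff_even]
  · simpa only [ZMod.natCast_eq_one_iff_odd] using hodd

-- Reading the edge from `w` to its parent `u` as an edge from `u` to `w` gives `X_u`.
theorem opX_parent_mem {u w : ι} (hw : IsResolved g p {w}) (hwu : p w = some u)
    (hC : sumX C ∈ hamiltonians g) (hu : u ∈ C) (hwC : w ∉ C) : opX u ∈ hamiltonians g := by
  have hE : sumE (fun _ => some w) {u} ∈ hamiltonians g := by
    have h := hw.sumE_mem
    rw [sumE, Finset.sum_singleton, hwu, optZ, Option.elim_some, opZ_mul_comm] at h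
    rwa [sumE, Finset.sum_singleton]
  have hdisj : Disjoint {u} (children (fun _ => some w) C) :=
    Finset.disjoint_singleton_left.2 fun h => hwC <| by
      obtain ⟨t, ht, hwt⟩ := mem_children.1 h
      rwa [Option.some.inj hwt]
  have hX := sumX_mem_of_subset hC hE (Finset.singleton_subset_iff.2 hu) hdisj
  rwa [sumX, Finset.sum_singleton] at hX

end IsResolved

end Resolved

section ParityProfile

variable {ι : Type*} {p : ι → Option ι}

/-- The value of `prof` at the parent of `w`, and the empty list if `w` is a root. -/
def parentProfile (p : ι → Option ι) (prof : ι → List (ZMod 2)) (w : ι) : List (ZMod 2) :=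
  (p w).elim [] prof

theorem parentProfile_eq_of_parent {prof : ι → List (ZMod 2)} {u w : ι} (hwu : p w = some u) :
    parentProfile p prof w = prof u := by
  rw [parentProfile, hwu, Option.elim_some]

variable [Fintype ι]

/-- The vertices on which the list-valued labelling `f` takes the value `l`. -/
def profileClass (f : ι → List (ZMod 2)) (l : List (ZMod 2)) : Finset ι := {w | f w = l}

theorem mem_profileClass {f : ι → List (ZMod 2)} {l : List (ZMod 2)} {w : ι} :
    w ∈ profileClass f l ↔ f w = l := by
  rw [profileClass, Finset.mem_filter_univ]

variable [DecidableEq ι]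

theorem disjoint_children_profileClass {f : ι → List (ZMod 2)}
    (hf : ∀ u w, p w = some u → f u ≠ f w) (l : List (ZMod 2)) :
    Disjoint (profileClass f l) (children p (profileClass f l)) := by
  refine Finset.disjoint_left.2 fun w hw hw' => ?_
  obtain ⟨u, hu, hwu⟩ := mem_children.1 hw'
  exact hf u w hwu ((mem_profileClass.1 hu).trans (mem_profileClass.1 hw).symm)

/-- `prof w` lists the degrees modulo `2` along the path from `w` up to its root, so that it is the
reversed parity-degree sequence of `w`. The degree counts one edge from each vertex to its parent,
also for the roots, whose parent is the deleted vertex. -/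
def IsParityProfile (p : ι → Option ι) (prof : ι → List (ZMod 2)) : Prop :=
  ∀ w, prof w = ((children p {w}).card + 1 : ZMod 2) :: parentProfile p prof w

variable {prof : ι → List (ZMod 2)}

namespace IsParityProfile

variable (h : IsParityProfile p prof)
include h

theorem length_parent_lt {u w : ι} (hwu : p w = some u) : (prof u).length < (prof w).length := by
  rw [h w, parentProfile_eq_of_parent hwu, List.length_cons]
  exact Nat.lt_succ_self _

theorem parent_ne {u w : ι} (hwu : p w = some u) : prof u ≠ prof w := fun huw =>
  (h.length_parent_lt hwu).ne (congrArg List.length huw)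

theorem parentProfile_parent_ne {u w : ι} (hwu : p w = some u) :
    parentProfile p prof u ≠ parentProfile p prof w := by
  rw [parentProfile_eq_of_parent hwu, h u]
  exact (List.cons_ne_self _ _).symm

theorem profileClass_parentProfile_nil : profileClass (parentProfile p prof) [] = roots p := by
  ext w
  rw [mem_profileClass, mem_roots, parentProfile]
  cases p w with
  | none => simp only [Option.elim_none]
  | some u => simp only [Option.elim_some, h u, reduceCtorEq]

theorem profileClass_cons (a : ZMod 2) (l : List (ZMod 2)) :
    profileClass prof (a :: l) =
      {w ∈ profileClass (parentProfile p prof) l | ((children p {w}).card : ZMod 2) = a - 1} := by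
  ext w
  rw [Finset.mem_filter, mem_profileClass, mem_profileClass, h w, List.cons.injEq,
    eq_sub_iff_add_eq, and_comm]

end IsParityProfile

theorem children_profileClass_cons (a : ZMod 2) (l : List (ZMod 2)) :
    children p (profileClass prof (a :: l)) = profileClass (parentProfile p prof) (a :: l) := by
  ext w
  rw [mem_children, mem_profileClass, parentProfile]
  cases p w <;> simp [mem_profileClass]

variable {g : LieSubalgebra ℝ (Op ι)}

theorem isResolved_profileClass_cons (h : IsParityProfile p prof)
    (huniv : IsResolved g p Finset.univ) {l : List (ZMod 2)}
    (hl : IsResolved g p (profileClass (parentProfile p prof) l)) (a : ZMod 2) :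
    IsResolved g p (profileClass prof (a :: l)) := by
  have hdisj := disjoint_children_profileClass (fun _ _ => h.parentProfile_parent_ne) l
  rw [h.profileClass_cons]
  exact hl.filter_parity_children (huniv.children hl hdisj).sumE_mem hdisj (a - 1)

theorem isResolved_profileClass_parentProfile (h : IsParityProfile p prof)
    (huniv : IsResolved g p Finset.univ) (l : List (ZMod 2)) :
    IsResolved g p (profileClass (parentProfile p prof) l) := by
  induction l with
  | nil => exact h.profileClass_parentProfile_nil ▸ huniv.roots
  | cons a l ih =>
    rw [← children_profileClass_cons]
    exact huniv.children (isResolved_profileClass_cons h huniv ih a)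
      (disjoint_children_profileClass (fun _ _ => h.parent_ne) _)

theorem isResolved_profileClass (h : IsParityProfile p prof) (huniv : IsResolved g p Finset.univ)
    (w : ι) : IsResolved g p (profileClass prof (prof w)) := by
  rw [h w]
  exact isResolved_profileClass_cons h huniv (isResolved_profileClass_parentProfile h huniv _) _

theorem isResolved_singleton (h : IsParityProfile p prof) (huniv : IsResolved g p Finset.univ)
    {w : ι} (hw : opX w ∈ hamiltonians g) : IsResolved g p {w} := by
  have hsub : {w} ⊆ profileClass prof (prof w) :=
    Finset.singleton_subset_iff.2 (mem_profileClass.2 rfl)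
  refine (isResolved_profileClass h huniv w).of_subset ?_ hsub
    ((disjoint_children_profileClass (fun _ _ => h.parent_ne) _).mono_right (children_mono hsub))
  rwa [sumX, Finset.sum_singleton]

theorem opX_mem_of_child (h : IsParityProfile p prof) (huniv : IsResolved g p Finset.univ)
    {c u : ι} (hcu : p c = some u) (hc : opX c ∈ hamiltonians g) : opX u ∈ hamiltonians g :=
  (isResolved_singleton h huniv hc).opX_parent_mem hcu (isResolved_profileClass h huniv u).sumX_mem
    (mem_profileClass.2 rfl) fun hcu' => h.parent_ne hcu (mem_profileClass.1 hcu').symm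

theorem opX_mem_of_profileClass (h : IsParityProfile p prof) (huniv : IsResolved g p Finset.univ)
    {w : ι} (hothers : ∀ u, u ≠ w → prof u = prof w → opX u ∈ hamiltonians g) :
    opX w ∈ hamiltonians g := by
  have hsum := (isResolved_profileClass h huniv w).sumX_mem
  rw [sumX, ← Finset.add_sum_erase _ _ (mem_profileClass.2 rfl)] at hsum
  refine (add_mem_cancel_right (sum_mem fun u hu => ?_)).1 hsum
  obtain ⟨huw, hu⟩ := Finset.mem_erase.1 hu
  exact hothers u huw (mem_profileClass.1 hu)

theorem opX_mem (h : IsParityProfile p prof) (huniv : IsResolved g p Finset.univ)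
    (hleaf : Set.InjOn prof {w | children p {w} = ∅}) (w : ι) : opX w ∈ hamiltonians g := by
  by_contra hw
  obtain ⟨w, hw, hmax⟩ := (Set.toFinite {w | opX w ∉ hamiltonians g}).exists_maximalFor
    (fun w => (prof w).length) _ ⟨w, hw⟩
  have hnonleaf {u : ι} (hu : prof u = prof w) (hchild : children p {u} ≠ ∅) :
      opX u ∈ hamiltonians g := by
    obtain ⟨c, hc⟩ := Finset.nonempty_iff_ne_empty.2 hchild
    have hcu := mem_children_singleton.1 hc
    refine opX_mem_of_child h huniv hcu (by_contra fun hc => ?_)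
    have hlt := h.length_parent_lt hcu
    rw [hu] at hlt
    exact (hmax hc hlt.le).not_gt hlt
  have hwleaf : children p {w} = ∅ := by_contra fun hchild => hw (hnonleaf rfl hchild)
  exact hw (opX_mem_of_profileClass h huniv fun u huw hu =>
    hnonleaf hu fun huleaf => huw (hleaf huleaf hwleaf hu))

theorem freeDLA_le {H : SimpleGraph ι} (hH : ∀ u w, H.Adj u w → p w = some u ∨ p u = some w)
    (h : IsParityProfile p prof) (huniv : IsResolved g p Finset.univ)
    (hleaf : Set.InjOn prof {w | children p {w} = ∅}) : freeDLA H ≤ g := by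
  have hX (w : ι) : opX w ∈ hamiltonians g := opX_mem h huniv hleaf w
  have hZZ {u w : ι} (hwu : p w = some u) : opZZ s(w, u) ∈ hamiltonians g := by
    have hE := (isResolved_singleton h huniv (hX w)).sumE_mem
    rwa [sumE, Finset.sum_singleton, hwu] at hE
  refine LieSubalgebra.lieSpan_le.2 ?_
  rintro _ (⟨w, rfl⟩ | ⟨e, he, rfl⟩)
  · exact hX w
  · induction e using Sym2.ind with
    | _ u w =>
      obtain hwu | huw := hH u w he
      · rw [Sym2.eq_swap]
        exact hZZ hwu
      · exact hZZ huw

end ParityProfile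

section ParentGraph

variable {ι : Type*} [Fintype ι] [DecidableEq ι] {p : ι → Option ι}

theorem sumE_roots (p : ι → Option ι) : sumE p (roots p) = ∑ w ∈ roots p, opZ w :=
  Finset.sum_congr rfl fun w hw => by
    rw [mem_roots.1 hw, optZ, Option.elim_none, mul_one]

theorem sum_edgeFinset_opZZ {H : SimpleGraph ι} [DecidableRel H.Adj]
    (hH : ∀ u w, H.Adj u w ↔ p w = some u ∨ p u = some w)
    (hasymm : ∀ u w, p w = some u → p u ≠ some w) :
    ∑ e ∈ H.edgeFinset, opZZ e = sumE p (roots p)ᶜ := by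
  have hsome (w : ι) (hw : w ∈ (roots p)ᶜ) : (p w).isSome := by
    rwa [Finset.mem_compl, mem_roots, ← ne_eq, ← Option.isSome_iff_ne_none] at hw
  refine (Finset.sum_bij (fun w hw => s(w, (p w).get (hsome w hw))) ?_ ?_ ?_ ?_).symm
  · intro w hw
    rw [SimpleGraph.mem_edgeFinset, SimpleGraph.mem_edgeSet, hH]
    exact .inr (Option.some_get _).symm
  · intro u hu w hw huw
    obtain ⟨h, -⟩ | ⟨hu', hw'⟩ := Sym2.eq_iff.1 huw
    · exact h
    · exact absurd (Option.eq_some_iff_get_eq.2 ⟨_, hw'⟩)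
        (hasymm u w (Option.eq_some_iff_get_eq.2 ⟨_, hu'.symm⟩))
  · intro e he
    have hsurj {u w : ι} (hwu : p w = some u) :
        ∃ a, ∃ ha : a ∈ (roots p)ᶜ, s(a, (p a).get (hsome a ha)) = s(w, u) := by
      have hw : w ∈ (roots p)ᶜ := by simp [mem_roots, hwu]
      exact ⟨w, hw, by simp only [hwu, Option.get_some]⟩
    induction e using Sym2.ind with
    | _ u w =>
      obtain hwu | huw := (hH u w).1 (SimpleGraph.mem_edgeFinset.1 he)
      · rw [Sym2.eq_swap]
        exact hsurj hwu
      · exact hsurj huw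
  · intro w hw
    conv_lhs => rw [← Option.some_get (hsome w hw)]
    rfl

end ParentGraph

section Tree

variable {V : Type*} {G : SimpleGraph V} (hG : G.IsTree) (v : V)

/-- The unique path from the root `v` to the vertex `w` of a tree. -/
def rootPath (w : V) : G.Walk v w := (hG.existsUnique_path v w).choose

theorem isPath_rootPath (w : V) : (rootPath hG v w).IsPath :=
  (hG.existsUnique_path v w).choose_spec.1

theorem length_rootPath (w : V) : (rootPath hG v w).length = G.dist v w := by
  obtain ⟨q, hq, hlen⟩ := hG.connected.exists_path_of_dist v w
  rw [← hlen, (hG.existsUnique_path v w).choose_spec.2 q hq]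
  rfl

theorem rootPath_self : rootPath hG v v = .nil :=
  (SimpleGraph.Walk.isPath_iff_nil.1 (isPath_rootPath hG v v)).eq_nil

variable {v}

theorem rootPath_eq_concat {w : V} (hw : w ≠ v) :
    ∃ h, rootPath hG v w = (rootPath hG v (rootPath hG v w).penultimate).concat h :=
  have hadj := (rootPath hG v w).adj_penultimate (SimpleGraph.Walk.not_nil_of_ne hw.symm)
  ⟨hadj, hG.isAcyclic.path_concat (isPath_rootPath hG v _) (isPath_rootPath hG v w) hadj
    ((rootPath hG v w).getVert_mem_support _)⟩

theorem adj_penultimate_rootPath {w : V} (hw : w ≠ v) : G.Adj (rootPath hG v w).penultimate w :=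
  (rootPath_eq_concat hG hw).1

theorem dist_penultimate_rootPath {w : V} (hw : w ≠ v) :
    G.dist v w = G.dist v (rootPath hG v w).penultimate + 1 := by
  obtain ⟨_, h⟩ := rootPath_eq_concat hG hw
  simpa only [SimpleGraph.Walk.length_concat, length_rootPath] using congrArg
    SimpleGraph.Walk.length h

theorem penultimate_rootPath_of_adj {u w : V} (h : G.Adj u w) :
    w ≠ v ∧ (rootPath hG v w).penultimate = u ∨ u ≠ v ∧ (rootPath hG v u).penultimate = w := by
  have of_mem {a b : V} (hab : G.Adj a b) (ha : a ∈ (rootPath hG v b).support) :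
      b ≠ v ∧ (rootPath hG v b).penultimate = a := by
    refine ⟨?_, (hG.isAcyclic.eq_penultimate_of_adj_end (isPath_rootPath hG v b) hab.symm ha).symm⟩
    rintro rfl
    rw [rootPath_self, SimpleGraph.Walk.support_nil, List.mem_singleton] at ha
    exact hab.ne ha
  by_cases hu : u ∈ (rootPath hG v w).support
  · exact .inl (of_mem h hu)
  · exact .inr (of_mem h.symm (hG.isAcyclic.mem_support_of_ne_mem_support_of_adj_of_isPath
      (isPath_rootPath hG v u) (isPath_rootPath hG v w) h hu))

section

variable [Fintype V] [DecidableRel G.Adj]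

theorem parityProfile_rootPath {w : V} (hw : w ≠ v) :
    parityProfile G (rootPath hG v w) =
      parityProfile G (rootPath hG v (rootPath hG v w).penultimate) ++ [(G.degree w : ZMod 2)] := by
  obtain ⟨_, h⟩ := rootPath_eq_concat hG hw
  conv_lhs => rw [h]
  rw [parityProfile, parityProfile, SimpleGraph.Walk.support_concat,
    List.tail_append_of_ne_nil (SimpleGraph.Walk.support_ne_nil _), List.map_append,
    List.map_singleton]

theorem length_parityProfile_rootPath (w : V) :
    (parityProfile G (rootPath hG v w)).length = G.dist v w := by
  rw [parityProfile, List.length_map, List.length_tail, SimpleGraph.Walk.length_support,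
    Nat.add_sub_cancel, length_rootPath]

end

variable [DecidableEq V]

/-- The parent of a vertex of a tree with root `v`, where `none` stands for the root. It turns the
tree with `v` deleted into a rooted forest. -/
def treeParent (w : {w : V // w ≠ v}) : Option {w : V // w ≠ v} :=
  if h : (rootPath hG v w).penultimate = v then none else some ⟨_, h⟩

theorem treeParent_eq_some {w u : {w : V // w ≠ v}} :
    treeParent hG w = some u ↔ (rootPath hG v w).penultimate = u := by
  unfold treeParent
  split_ifs with h
  · exact iff_of_false nofun fun hu => u.2 (hu.symm.trans h)
  · rw [Option.some.injEq, Subtype.ext_iff]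

theorem treeParent_eq_none {w : {w : V // w ≠ v}} :
    treeParent hG w = none ↔ (rootPath hG v w).penultimate = v := by
  unfold treeParent
  split_ifs with h <;> simp [h]

theorem adj_iff_treeParent (u w : {w : V // w ≠ v}) :
    (reducedGraph G v).Adj u w ↔ treeParent hG w = some u ∨ treeParent hG u = some w := by
  simp only [treeParent_eq_some, SimpleGraph.comap_adj]
  refine ⟨fun h => (penultimate_rootPath_of_adj hG h).imp And.right And.right, ?_⟩
  rintro (h | h)
  · rw [← h]
    exact adj_penultimate_rootPath hG w.2
  · rw [← h]
    exact (adj_penultimate_rootPath hG u.2).symm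

theorem adj_root_iff_treeParent (w : {w : V // w ≠ v}) :
    G.Adj v w ↔ treeParent hG w = none := by
  rw [treeParent_eq_none]
  constructor
  · intro h
    exact (penultimate_rootPath_of_adj hG h).elim And.right fun h => absurd rfl h.1
  · intro h
    simpa only [h] using adj_penultimate_rootPath hG w.2

theorem treeParent_asymm (u w : {w : V // w ≠ v}) (hwu : treeParent hG w = some u) :
    treeParent hG u ≠ some w := fun huw => by
  have hw := dist_penultimate_rootPath hG w.2
  have hu := dist_penultimate_rootPath hG u.2
  rw [(treeParent_eq_some hG).1 hwu] at hw
  rw [(treeParent_eq_some hG).1 huw] at hu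
  omega

variable [Fintype V] [DecidableRel G.Adj]

theorem reducedProblem_eq_sumE : reducedProblem G v = sumE (treeParent hG) Finset.univ := by
  have hroots : ({w | G.Adj v w.1} : Finset {w : V // w ≠ v}) = roots (treeParent hG) :=
    Finset.filter_congr fun w _ => adj_root_iff_treeParent hG w
  have hedges : ∑ e ∈ (reducedGraph G v).edgeFinset, opZZ e =
      sumE (treeParent hG) (roots (treeParent hG))ᶜ :=
    sum_edgeFinset_opZZ (adj_iff_treeParent hG) (treeParent_asymm hG)
  rw [reducedProblem, hroots, ← sumE_roots, hedges]
  exact Finset.sum_compl_add_sum _ _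

theorem degree_eq_card_children (w : {w : V // w ≠ v}) :
    G.degree w = (children (treeParent hG) {w}).card + 1 := by
  have hnbhd : G.neighborFinset w = insert (rootPath hG v w).penultimate
      ((children (treeParent hG) {w}).image Subtype.val) := by
    ext u
    simp only [SimpleGraph.mem_neighborFinset, Finset.mem_insert, Finset.mem_image,
      mem_children_singleton, treeParent_eq_some]
    constructor
    · intro h
      obtain ⟨hu, hp⟩ | ⟨-, hp⟩ := penultimate_rootPath_of_adj hG h
      · exact .inr ⟨⟨u, hu⟩, hp, rfl⟩
      · exact .inl hp.symm
    · rintro (rfl | ⟨c, hc, rfl⟩)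
      · exact (adj_penultimate_rootPath hG w.2).symm
      · exact hc ▸ adj_penultimate_rootPath hG c.2
  rw [← SimpleGraph.card_neighborFinset_eq_degree, hnbhd, Finset.card_insert_of_notMem,
    Finset.card_image_of_injective _ Subtype.val_injective]
  rw [Finset.mem_image]
  rintro ⟨c, hc, hcw⟩
  exact treeParent_asymm hG w c (mem_children_singleton.1 hc)
    ((treeParent_eq_some hG).2 hcw.symm)

theorem isParityProfile_reverse_parityProfile :
    IsParityProfile (treeParent hG) fun w : {w : V // w ≠ v} =>
      (parityProfile G (rootPath hG v w)).reverse := by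
  intro w
  have hparent : (parityProfile G (rootPath hG v (rootPath hG v w).penultimate)).reverse =
      parentProfile (treeParent hG)
        (fun w => (parityProfile G (rootPath hG v w)).reverse) w := by
    cases h : treeParent hG w with
    | none =>
      rw [parentProfile, h, Option.elim_none, (treeParent_eq_none hG).1 h, rootPath_self]
      rfl
    | some u => rw [parentProfile_eq_of_parent h, (treeParent_eq_some hG).1 h]
  change (parityProfile G (rootPath hG v w)).reverse = _
  rw [parityProfile_rootPath hG w.2, List.reverse_append, hparent, degree_eq_card_children hG w,
    Nat.cast_add_one]
  rfl

end Tree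

end

end QAOA

theorem mainTheorem7 {V : Type*} [Fintype V] [DecidableEq V] (G : SimpleGraph V)
    [DecidableRel G.Adj] (hconn : G.Connected) (hacyc : G.IsAcyclic) (v : V)
    (hleaf : ∀ j : ℕ, 0 < j → ∀ w w' : V,
      G.dist v w = j → G.degree w = 1 → G.dist v w' = j → G.degree w' = 1 → w ≠ w' →
      ∀ (p : G.Path v w) (p' : G.Path v w'),
        QAOA.parityProfile G p.1 ≠ QAOA.parityProfile G p'.1) :
    QAOA.freeDLA (QAOA.reducedGraph G v) ≤ QAOA.standardReducedDLA G v := by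
  have hG : G.IsTree := ⟨hconn, hacyc⟩
  have huniv : QAOA.IsResolved (QAOA.standardReducedDLA G v) (QAOA.treeParent hG) Finset.univ :=
    { sumX_mem := LieSubalgebra.subset_lieSpan (Set.mem_insert _ _)
      sumE_mem := QAOA.reducedProblem_eq_sumE hG ▸
        LieSubalgebra.subset_lieSpan (Set.mem_insert_of_mem _ rfl) }
  refine QAOA.freeDLA_le (fun u w => (QAOA.adj_iff_treeParent hG u w).1)
    (QAOA.isParityProfile_reverse_parityProfile hG) huniv fun w hw w' hw' hprof => ?_
  have hdegree (u : {u // u ≠ v}) (hu : QAOA.children (QAOA.treeParent hG) {u} = ∅) :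
      G.degree u = 1 := by
    rw [QAOA.degree_eq_card_children hG, hu, Finset.card_empty]
  replace hprof := List.reverse_injective hprof
  have hdist : G.dist v w' = G.dist v w := by
    rw [← QAOA.length_parityProfile_rootPath hG, ← hprof, QAOA.length_parityProfile_rootPath]
  by_contra hne
  exact hleaf _ (hconn.pos_dist_of_ne w.2.symm) w w' rfl (hdegree w hw) hdist (hdegree w' hw')
    (Subtype.coe_injective.ne hne) ⟨_, QAOA.isPath_rootPath hG v w⟩
    ⟨_, QAOA.isPath_rootPath hG v w'⟩ hprof
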